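/- Let $K$ be an algebraically closed field of arbitrary characteristic. For $0\le m\le n$, let $Gr(m;n)$ denote the Grassmannian of $m$-dimensional linear subspaces of $K^n$. A *dimension vector* of length $k$ is a tuple $\mathbf d=(d_1,\dots,d_k;n)$ of integers with $1\le d_i\le n-1$ for all $i$. It is called *dense* if the diagonal action of $PGL(n)$ on $\prod_{i=1}^k Gr(d_i;n)$ has a Zariski dense orbit, and *sparse* otherwise. Let $\mathbf d=(d_1,\dots,d_k;n)$ be a dimension vector of length $k\le 4$. Then $\mathbf d$ is sparse if and only if $k=4$ and $d_1+d_2+d_3+d_4=2n$. In particular, every dimension vector of length $2$ or $3$ is dense, i.e. $PGL(n)$ has a dense orbit on the corresponding product of Grassmannians. -/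

import Mathlib

open scoped MatrixGroups

noncomputable section

namespace GrassmannDensity

/-! ### The Grassmannian and the action of `PGL(n)` -/

/-- The Grassmannian `Gr(d; n)`: the `d`-dimensional linear subspaces of `K ^ n`. -/
def Gr (K : Type*) [Field K] (d n : ℕ) : Type _ :=
  {U : Submodule K (Fin n → K) // Module.finrank K U = d}

/-- `GL(n, K)` moves a subspace `U` of `K ^ n` to its image `g U`. -/
instance Gr.instMulActionGL (K : Type*) [Field K] (d n : ℕ) :
    MulAction (GL (Fin n) K) (Gr K d n) where
  smul g U :=
    ⟨U.1.map (Matrix.mulVecLin (g : Matrix (Fin n) (Fin n) K)), by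
      rw [← Matrix.GeneralLinearGroup.coe_toLin]
      exact ((Matrix.GeneralLinearGroup.toLin g).toLinearEquiv.finrank_map_eq U.1).trans U.2⟩
  one_smul U := by
    apply Subtype.ext
    change Submodule.map (Matrix.mulVecLin ((1 : GL (Fin n) K) : Matrix (Fin n) (Fin n) K)) U.1 = U.1
    rw [Units.val_one, Matrix.mulVecLin_one, Submodule.map_id]
  mul_smul g h U := by
    apply Subtype.ext
    change Submodule.map (Matrix.mulVecLin ((g * h : GL (Fin n) K) : Matrix (Fin n) (Fin n) K)) U.1 =
      Submodule.map _ (Submodule.map _ U.1)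
    rw [Units.val_mul, Matrix.mulVecLin_mul, Submodule.map_comp]

theorem Gr.coe_smul {K : Type*} [Field K] {d n : ℕ} (g : GL (Fin n) K) (U : Gr K d n) :
    (g • U).1 = U.1.map (Matrix.mulVecLin (g : Matrix (Fin n) (Fin n) K)) := by
  rfl

/-- Scalar matrices fix every subspace, so the action descends to `PGL(n, K)`.  The action of
`PGL(n, K)` on a product of Grassmannians is then the diagonal one. -/
instance Gr.instMulActionPGL (K : Type*) [Field K] (d n : ℕ) :
    MulAction (PGL(n, K)) (Gr K d n) :=
  Matrix.ProjGenLinGroup.mulActionOfGL fun u U => by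
    apply Subtype.ext
    rw [Gr.coe_smul]
    ext x
    simp only [Submodule.mem_map]
    constructor
    · rintro ⟨y, hy, rfl⟩
      simpa [Matrix.mulVecLin_apply] using U.1.smul_mem (u : K) hy
    · intro hx
      refine ⟨((u⁻¹ : Kˣ) : K) • x, U.1.smul_mem _ hx, ?_⟩
      simp

/-! ### The Zariski topology -/

/-- The Zariski topology on the affine space `K ^ σ`: the closed sets are the common zero loci of
ideals of polynomials. -/
@[reducible]
def affineZariski (σ K : Type*) [Field K] : TopologicalSpace (σ → K) :=
  TopologicalSpace.ofClosed
    {Z | ∃ I : Ideal (MvPolynomial σ K), Z = MvPolynomial.zeroLocus K I}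
    ⟨⊤, by simp⟩
    (by
      intro A hA
      refine ⟨MvPolynomial.vanishingIdeal K (⋂₀ A), subset_antisymm
        (MvPolynomial.zeroLocus_vanishingIdeal_le _) ?_⟩
      intro x hx Z hZ
      obtain ⟨I, rfl⟩ := hA hZ
      exact fun p hp => hx p fun y hy => hy _ hZ p hp)
    (by
      rintro _ ⟨I, rfl⟩ _ ⟨J, rfl⟩
      refine ⟨I * J, subset_antisymm ?_ ?_⟩
      · rintro x (hx | hx) p hp
        · exact hx p ((Ideal.mul_le_left : I * J ≤ I) hp)
        · exact hx p ((Ideal.mul_le_right : I * J ≤ J) hp)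
      · intro x hx
        by_contra hn
        rw [Set.mem_union, not_or] at hn
        obtain ⟨hI, hJ⟩ := hn
        simp only [MvPolynomial.mem_zeroLocus_iff, not_forall] at hI hJ
        obtain ⟨p, hp, hpx⟩ := hI
        obtain ⟨q, hq, hqx⟩ := hJ
        have h := hx (p * q) (Ideal.mul_mem_mul hp hq)
        rw [map_mul] at h
        exact mul_ne_zero hpx hqx h)

theorem isClosed_affineZariski_iff {σ K : Type*} [Field K] {Z : Set (σ → K)} :
    @IsClosed _ (affineZariski σ K) Z ↔
      ∃ I : Ideal (MvPolynomial σ K), Z = MvPolynomial.zeroLocus K I := by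
  let _ := affineZariski σ K
  rw [← isOpen_compl_iff]
  change Zᶜᶜ ∈ {Z | ∃ I : Ideal (MvPolynomial σ K), Z = MvPolynomial.zeroLocus K I} ↔ _
  rw [compl_compl, Set.mem_ofPred_eq]

/-- The variety of `k`-tuples of frames: `k`-tuples of matrices of sizes `n × d i` and rank `d i`,
that is, with linearly independent columns. -/
def Frames (K : Type*) [Field K] {k : ℕ} (d : Fin k → ℕ) (n : ℕ) : Type _ :=
  {A : (i : Fin k) → Matrix (Fin n) (Fin (d i)) K // ∀ i, LinearIndependent K (A i).col}

/-- The Zariski topology on tuples of frames, a subspace of the affine space of all tuples of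
matrices, whose coordinates are the matrix entries. -/
@[reducible]
def framesZariski (K : Type*) [Field K] {k : ℕ} (d : Fin k → ℕ) (n : ℕ) :
    TopologicalSpace (Frames K d n) :=
  (affineZariski ((i : Fin k) × Fin n × Fin (d i)) K).induced
    fun A e => A.1 e.1 e.2.1 e.2.2

/-- The column spaces of a tuple of frames, a point of `∏ i, Gr(d i; n)`. -/
def Frames.toGr {K : Type*} [Field K] {k : ℕ} {d : Fin k → ℕ} {n : ℕ} (A : Frames K d n) :
    (i : Fin k) → Gr K (d i) n :=
  fun i => ⟨Submodule.span K (Set.range (A.1 i).col), by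
    rw [finrank_span_eq_card (A.2 i), Fintype.card_fin]⟩

/-- The Zariski topology on `∏ i, Gr(d i; n)`.  The product of Grassmannians is the geometric
quotient of the variety of tuples of frames by `∏ i, GL(d i)` (the quotient map is a Zariski
locally trivial principal bundle), so its Zariski topology is the quotient topology: a set is
closed if and only if the tuples of frames spanning a point of it form a Zariski closed set.
(This is the topology of the product variety, not the product of the Zariski topologies.) -/
@[reducible]
def grassmannZariski (K : Type*) [Field K] {k : ℕ} (d : Fin k → ℕ) (n : ℕ) :
    TopologicalSpace ((i : Fin k) → Gr K (d i) n) :=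
  (framesZariski K d n).coinduced Frames.toGr

/-! ### Dimension vectors -/

/-- A dimension vector `(d₁, …, d_k; n)` of length `k`, with `1 ≤ d_i ≤ n - 1`. -/
structure DimensionVector (k : ℕ) where
  /-- the dimensions `d₁, …, d_k` of the subspaces -/
  dim : Fin k → ℕ
  /-- the ambient dimension `n` -/
  ambient : ℕ
  pos : ∀ i, 0 < dim i
  lt_ambient : ∀ i, dim i < ambient

/-- `(d₁, …, d_k; n)` is dense over `K` if the diagonal action of `PGL(n, K)` on
`∏ i, Gr(d i; n)` has a Zariski dense orbit. -/
def DimensionVector.IsDense (K : Type*) [Field K] {k : ℕ} (d : DimensionVector k) : Prop :=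
  ∃ U : (i : Fin k) → Gr K (d.dim i) d.ambient,
    @Dense _ (grassmannZariski K d.dim d.ambient)
      (MulAction.orbit (PGL(d.ambient, K)) U)

/-- A dimension vector is sparse over `K` if it is not dense. -/
def DimensionVector.IsSparse (K : Type*) [Field K] {k : ℕ} (d : DimensionVector k) : Prop :=
  ¬ d.IsDense K

end GrassmannDensity

end

noncomputable section

namespace GrassmannDensity

open Module

/-! ### Rigid configurations of subspaces -/

/-! Density is linearized. The orbit map of a configuration `U` has differential End(V) → ⊕ Hom(U i,
V/U i), and `Rigid` says that it is onto. Over an infinite field of any characteristic this makes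
the orbit dense (`Rigid.dense_orbit`), so density reduces to finding one rigid configuration.

Rank-nullity makes rigidity an upper bound on the dimension of the stabilizer
(`rigid_iff_finrank_stab`). Configurations with ∑ d i < 2n are built by induction on n: coordinate
subspaces when ∑ d i ≤ n; splitting off a summand that lies in one subspace only
(`Rigid.prod_update`); otherwise a reflection functor for subspace representations
(`Rigid.exists_reflection`), which lowers n to ∑ d i - n. Sums above 2n follow by duality, and fewer
than four subspaces are padded.

If k = 4 and ∑ d i = 2n, tensoring the subspaces with four vectors of cross-ratio c in the plane
gives a square matrix. Its determinant f_c is a semi-invariant whose weight does not depend on c, so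
f_b / f_c is invariant and would be constant if an orbit were dense. Configurations containing four
lines of cross-ratio b as a summand, on which f_b vanishes and f_c does not, rule this out
(`not_dense_orbit`). -/

/-- A family of subspaces is rigid if every infinitesimal deformation of it comes from an
endomorphism of the ambient space. -/
def Rigid {K V ι : Type*} [Field K] [AddCommGroup V] [Module K V] (U : ι → Submodule K V) : Prop :=
  ∀ φ : ι → V →ₗ[K] V, ∃ X : V →ₗ[K] V, ∀ i, ∀ u ∈ U i, X u - φ i u ∈ U i

/-- The infinitesimal action of an endomorphism on a family of subspaces. -/
def deform {K V ι : Type*} [Field K] [AddCommGroup V] [Module K V] (U : ι → Submodule K V) :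
    (V →ₗ[K] V) →ₗ[K] ((i : ι) → U i →ₗ[K] V ⧸ U i) where
  toFun X i := (U i).mkQ ∘ₗ X ∘ₗ (U i).subtype
  map_add' X Y := by ext; simp
  map_smul' c X := by ext; simp

/-- The endomorphisms preserving every subspace of a family. -/
def stab {K V ι : Type*} [Field K] [AddCommGroup V] [Module K V] (U : ι → Submodule K V) :
    Submodule K (V →ₗ[K] V) :=
  LinearMap.ker (deform U)

section

variable {K V W ι : Type*} [Field K] [AddCommGroup V] [Module K V] [AddCommGroup W] [Module K W]

theorem mem_stab {U : ι → Submodule K V} {X : V →ₗ[K] V} :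
    X ∈ stab U ↔ ∀ i, ∀ u ∈ U i, X u ∈ U i := by
  simp only [stab, LinearMap.mem_ker, funext_iff, LinearMap.ext_iff, deform, LinearMap.coe_mk,
    AddHom.coe_mk, LinearMap.comp_apply, Subtype.forall, Submodule.subtype_apply,
    Submodule.mkQ_apply, Pi.zero_apply, LinearMap.zero_apply, Submodule.Quotient.mk_eq_zero]

theorem rigid_iff_surjective {U : ι → Submodule K V} :
    Rigid U ↔ Function.Surjective (deform U) := by
  constructor
  · intro h ψ
    have key : ∀ i, ∃ f : V →ₗ[K] V, (U i).mkQ ∘ₗ f ∘ₗ (U i).subtype = ψ i := by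
      intro i
      obtain ⟨g, hg⟩ := LinearMap.exists_extend (ψ i)
      obtain ⟨s, hs⟩ := (U i).mkQ.exists_rightInverse_of_surjective (U i).range_mkQ
      refine ⟨s ∘ₗ g, ?_⟩
      rw [LinearMap.comp_assoc, hg, ← LinearMap.comp_assoc, hs, LinearMap.id_comp]
    choose f hf using key
    obtain ⟨X, hX⟩ := h f
    refine ⟨X, funext fun i => ?_⟩
    rw [← hf i]
    ext u
    exact (Submodule.Quotient.eq (U i)).2 (hX i u u.2)
  · intro h φ
    obtain ⟨X, hX⟩ := h fun i => (U i).mkQ ∘ₗ φ i ∘ₗ (U i).subtype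
    refine ⟨X, fun i u hu => ?_⟩
    exact (Submodule.Quotient.eq (U i)).1 (LinearMap.congr_fun (congrFun hX i) ⟨u, hu⟩)

/-- Rank-nullity for `deform U`. The opposite inequality always holds, so rigidity passes between
configurations once their stabilizers are compared. -/
theorem rigid_iff_finrank_stab [FiniteDimensional K V] [Fintype ι] {U : ι → Submodule K V} :
    Rigid U ↔ finrank K (stab U) + ∑ i, finrank K (U i) * finrank K (V ⧸ U i) ≤
      finrank K V * finrank K V := by
  have h1 := (deform U).finrank_range_add_finrank_ker
  have h2 : finrank K ((i : ι) → U i →ₗ[K] V ⧸ U i) =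
      ∑ i, finrank K (U i) * finrank K (V ⧸ U i) := by
    rw [finrank_pi_fintype]
    simp only [finrank_linearMap]
  have h3 := Submodule.finrank_le (LinearMap.range (deform U))
  rw [finrank_linearMap] at h1
  rw [rigid_iff_surjective, ← LinearMap.range_eq_top, stab, ← h2]
  constructor
  · intro h
    rw [h, finrank_top] at h1
    omega
  · intro h
    exact Submodule.eq_top_of_finrank_eq (by omega)

theorem Rigid.map {U : ι → Submodule K V} (h : Rigid U) (e : V ≃ₗ[K] W) :
    Rigid fun i => (U i).map (e : V →ₗ[K] W) := by
  intro φ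
  obtain ⟨X, hX⟩ := h fun i => (e.symm : W →ₗ[K] V) ∘ₗ φ i ∘ₗ (e : V →ₗ[K] W)
  refine ⟨(e : V →ₗ[K] W) ∘ₗ X ∘ₗ (e.symm : W →ₗ[K] V), fun i w hw => ?_⟩
  obtain ⟨u, hu, rfl⟩ := hw
  refine ⟨_, hX i u hu, ?_⟩
  simp

theorem Rigid.comp {κ : Type*} {U : ι → Submodule K V} (h : Rigid U) {f : κ → ι}
    (hf : Function.Injective f) : Rigid (U ∘ f) := by
  intro φ
  obtain ⟨X, hX⟩ := h (Function.extend f φ 0)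
  refine ⟨X, fun i u hu => ?_⟩
  simpa [hf.extend_apply] using hX (f i) u hu

theorem Rigid.update_top [DecidableEq ι] {U : ι → Submodule K V} (h : Rigid U) (i : ι) :
    Rigid (Function.update U i ⊤) := by
  intro φ
  obtain ⟨X, hX⟩ := h φ
  refine ⟨X, fun j u hu => ?_⟩
  by_cases hj : j = i
  · subst hj; simp
  · rw [Function.update_of_ne hj] at hu ⊢
    exact hX j u hu

/-- A linear relation, total on `S` and determining `a` from `b`, replaces an explicit injection of
`S` into `T`. -/
theorem finrank_le_of_relation {A B : Type*} [AddCommGroup A] [Module K A] [AddCommGroup B]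
    [Module K B] [FiniteDimensional K A] [FiniteDimensional K B] {S : Submodule K A}
    {T : Submodule K B} (R : Submodule K (A × B)) (hex : ∀ a ∈ S, ∃ b ∈ T, (a, b) ∈ R)
    (hinj : ∀ a, (a, (0 : B)) ∈ R → a = 0) : finrank K S ≤ finrank K T := by
  let R' := R ⊓ S.prod T
  have h1 : S ≤ R'.map (LinearMap.fst K A B) := by
    intro a ha
    obtain ⟨b, hb, hab⟩ := hex a ha
    exact ⟨(a, b), ⟨hab, ha, hb⟩, rfl⟩
  have h2 : R'.map (LinearMap.snd K A B) ≤ T := by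
    rintro _ ⟨x, hx, rfl⟩
    exact hx.2.2
  have h3 : finrank K (R'.map (LinearMap.snd K A B)) = finrank K R' := by
    rw [← LinearMap.range_domRestrict]
    refine LinearMap.finrank_range_of_inj ((injective_iff_map_eq_zero _).2 ?_)
    rintro ⟨⟨a, b⟩, hab⟩ hb
    obtain rfl : b = 0 := hb
    obtain rfl := hinj a hab.1
    rfl
  calc finrank K S ≤ _ := Submodule.finrank_mono h1
    _ ≤ finrank K R' := Submodule.finrank_map_le _ _
    _ = _ := h3.symm
    _ ≤ _ := Submodule.finrank_mono h2

/-! ### Consequences of rigidity -/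

/-- Testing rigidity on rank-one maps that send a common vector v ≠ 0 to arbitrary vectors shows
that V → ∏ V/U j is onto. By dimension it is then injective, yet it kills v. This supplies the
general position needed for the reflection. -/
theorem Rigid.eq_zero_of_mem [FiniteDimensional K V] {U : ι → Submodule K V}
    (h : Rigid U) (s : Finset ι) (hs : finrank K V ≤ ∑ j ∈ s, finrank K (V ⧸ U j)) {v : V}
    (hv : ∀ j ∈ s, v ∈ U j) : v = 0 := by
  by_contra hv0
  obtain ⟨ξ, hξ⟩ : ∃ ξ : V →ₗ[K] K, ξ v = 1 := by
    obtain ⟨f, hf⟩ := Projective.exists_dual_eq_one K hv0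
    exact ⟨f, hf⟩
  let T : V →ₗ[K] ((j : s) → V ⧸ U j) := LinearMap.pi fun j => (U j).mkQ
  have hT : Function.Surjective T := by
    intro b
    choose w hw using fun j : s => (U j).mkQ_surjective (b j)
    classical
    obtain ⟨X, hX⟩ := h fun j => if hj : j ∈ s then ξ.smulRight (w ⟨j, hj⟩) else 0
    refine ⟨X v, funext fun j => ?_⟩
    have := hX j v (hv j j.2)
    simp only [j.2, dite_true, LinearMap.smulRight_apply, hξ, one_smul] at this
    rw [← hw j]
    exact (Submodule.Quotient.eq _).2 this
  have hrank : finrank K ((j : s) → V ⧸ U j) = ∑ j ∈ s, finrank K (V ⧸ U j) := by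
    rw [finrank_pi_fintype, Finset.sum_coe_sort s fun j => finrank K (V ⧸ U j)]
  have hle := LinearMap.finrank_le_finrank_of_surjective hT
  have hinj := (LinearMap.injective_iff_surjective_of_finrank_eq_finrank
    (by omega : finrank K V = finrank K ((j : s) → V ⧸ U j))).2 hT
  refine hv0 (hinj ?_)
  rw [map_zero]
  exact funext fun j => (Submodule.Quotient.mk_eq_zero _).2 (hv j j.2)

theorem Rigid.exists_functional [FiniteDimensional K V] {U : ι → Submodule K V}
    (h : Rigid U) (s : Finset ι) (hs : ∑ j ∈ s, finrank K (U j) = finrank K V)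
    (β : ι → V →ₗ[K] K) : ∃ ξ : V →ₗ[K] K, ∀ j ∈ s, ∀ u ∈ U j, ξ u = β j u := by
  let T : (V →ₗ[K] K) →ₗ[K] ((j : s) → U j →ₗ[K] K) :=
    LinearMap.pi fun j => LinearMap.lcomp K K (U j).subtype
  by_cases hT : Function.Injective T
  · have hrank : finrank K (V →ₗ[K] K) = finrank K ((j : s) → U j →ₗ[K] K) := by
      rw [finrank_pi_fintype]
      simp only [finrank_linearMap, finrank_self, mul_one]
      rw [Finset.sum_coe_sort s fun j => finrank K (U j), hs]
    obtain ⟨ξ, hξ⟩ := (LinearMap.injective_iff_surjective_of_finrank_eq_finrank hrank).1 hT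
      fun j => β j ∘ₗ (U j).subtype
    exact ⟨ξ, fun j hj u hu => LinearMap.congr_fun (congrFun hξ ⟨j, hj⟩) ⟨u, hu⟩⟩
  -- Some nonzero ξ₀ kills every U j. Deforming by β j ⊗ v with ξ₀ v = 1 makes ξ₀ ∘ X the required
  -- functional.
  · rw [injective_iff_map_eq_zero] at hT
    push Not at hT
    obtain ⟨ξ₀, h0, hne⟩ := hT
    obtain ⟨v, hv⟩ : ∃ v, ξ₀ v = 1 := by
      obtain ⟨w, hw⟩ := DFunLike.ne_iff.1 hne
      exact ⟨(ξ₀ w)⁻¹ • w, by simpa using inv_mul_cancel₀ hw⟩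
    obtain ⟨X, hX⟩ := h fun j => (β j).smulRight v
    refine ⟨ξ₀ ∘ₗ X, fun j hj u hu => ?_⟩
    have : ξ₀ (X u - β j u • v) = 0 := LinearMap.congr_fun (congrFun h0 ⟨j, hj⟩) ⟨_, hX j u hu⟩
    rw [map_sub, map_smul, hv, smul_eq_mul, mul_one, sub_eq_zero] at this
    exact this

/-! ### Constructions of rigid configurations -/

/-- In block form, the V → V part comes from the rigidity of U and the K^r → V part from φ i. The V
→ K^r part is constrained only by the indices j ≠ i, where `hglue` provides it. -/
theorem Rigid.prod_update [DecidableEq ι] {U : ι → Submodule K V} (h : Rigid U) (i : ι)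
    (hglue : ∀ β : ι → V →ₗ[K] K, ∃ ξ : V →ₗ[K] K, ∀ j, j ≠ i → ∀ u ∈ U j, ξ u = β j u) (r : ℕ) :
    Rigid fun j => (U j).prod (if j = i then (⊤ : Submodule K (Fin r → K)) else ⊥) := by
  intro φ
  obtain ⟨X, hX⟩ := h fun j => LinearMap.fst K V (Fin r → K) ∘ₗ φ j ∘ₗ LinearMap.inl K V (Fin r → K)
  choose ξ hξ using fun a : Fin r => hglue fun j =>
    LinearMap.proj a ∘ₗ LinearMap.snd K V (Fin r → K) ∘ₗ φ j ∘ₗ LinearMap.inl K V (Fin r → K)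
  let Y : (Fin r → K) →ₗ[K] V :=
    LinearMap.fst K V (Fin r → K) ∘ₗ φ i ∘ₗ LinearMap.inr K V (Fin r → K)
  refine ⟨(X.coprod Y).prod (LinearMap.pi ξ ∘ₗ LinearMap.fst K V (Fin r → K)), ?_⟩
  rintro j ⟨u, w⟩ ⟨hu, hw⟩
  have hsplit : φ j (u, w) = φ j (u, 0) + φ j (0, w) := by rw [← map_add]; simp
  by_cases hj : j = i
  · subst hj
    refine ⟨?_, by simp⟩
    have := hX j u hu
    rw [hsplit]
    simpa [Y] using this
  · rw [if_neg hj] at hw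
    obtain rfl : w = 0 := by simpa using hw
    refine ⟨by simpa using hX j u hu, ?_⟩
    simp only [hj, if_false]
    refine (Submodule.mem_bot K).2 (funext fun a => ?_)
    simpa [sub_eq_zero] using hξ a j hj u hu

theorem rigid_coordinate [Fintype ι] [DecidableEq ι] (d : ι → ℕ) (r : ℕ) :
    Rigid fun i => LinearMap.range (LinearMap.inl K ((i : ι) → Fin (d i) → K) (Fin r → K) ∘ₗ
      LinearMap.single K (fun i => Fin (d i) → K) i) := by
  intro φ
  refine ⟨∑ i, φ i ∘ₗ LinearMap.inl K ((i : ι) → Fin (d i) → K) (Fin r → K) ∘ₗ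
    LinearMap.single K (fun i => Fin (d i) → K) i ∘ₗ LinearMap.proj i ∘ₗ
    LinearMap.fst K _ (Fin r → K), ?_⟩
  rintro i _ ⟨u, rfl⟩
  convert Submodule.zero_mem _
  rw [sub_eq_zero, LinearMap.sum_apply, Finset.sum_eq_single i]
  · simp
  · intro j _ hj
    simp only [LinearMap.comp_apply, LinearMap.single_apply, LinearMap.inl_apply,
      LinearMap.fst_apply, LinearMap.proj_apply, Pi.single_eq_of_ne hj, map_zero]
  · simp

theorem exists_comp_eq_of_injective {A B C : Type*} [AddCommGroup A] [Module K A] [AddCommGroup B]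
    [Module K B] [AddCommGroup C] [Module K C] {f : A →ₗ[K] B} (hf : Function.Injective f)
    (g : C →ₗ[K] B) (h : ∀ c, g c ∈ LinearMap.range f) : ∃ l : C →ₗ[K] A, ∀ c, f (l c) = g c := by
  refine ⟨(LinearEquiv.ofInjective f hf).symm.toLinearMap ∘ₗ g.codRestrict _ h, fun c => ?_⟩
  have := (LinearEquiv.ofInjective f hf).apply_symm_apply (g.codRestrict _ h c)
  exact congrArg Subtype.val this

/-- The new space is the cokernel of δ : V → ⊕ V/U i, with the images of the V/U i as subspaces;
`hU` makes these embed. An endomorphism preserving the images lifts to ⊕ V/U i, preserves the range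
of δ and restricts to V, so the stabilizer does not grow. -/
theorem Rigid.exists_reflection [FiniteDimensional K V] [Fintype ι] [Nonempty ι]
    {U : ι → Submodule K V} (h : Rigid U)
    (hU : ∀ i v, (∀ j, j ≠ i → v ∈ U j) → v = 0) {m : ℕ}
    (hm : m + finrank K V = ∑ i, finrank K (V ⧸ U i)) :
    ∃ U' : ι → Submodule K (Fin m → K),
      (∀ i, finrank K (U' i) = finrank K (V ⧸ U i)) ∧ Rigid U' := by
  classical
  let δ : V →ₗ[K] ((i : ι) → V ⧸ U i) := LinearMap.pi fun i => (U i).mkQ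
  have hδinj : Function.Injective δ := by
    rw [injective_iff_map_eq_zero]
    intro v hv
    obtain ⟨i⟩ : Nonempty ι := inferInstance
    exact hU i v fun j _ => (Submodule.Quotient.mk_eq_zero _).1 (congrFun hv j)
  let π := (LinearMap.range δ).mkQ
  have hπ : ∀ x, π x = 0 ↔ ∃ v, δ v = x := fun x => Submodule.Quotient.mk_eq_zero _
  let σ : (i : ι) → (V ⧸ U i) →ₗ[K] _ := fun i => π ∘ₗ LinearMap.single K (fun i => V ⧸ U i) i
  have hσinj : ∀ i, Function.Injective (σ i) := by
    intro i
    rw [injective_iff_map_eq_zero]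
    intro q hq
    obtain ⟨v, hv⟩ := (hπ _).1 hq
    have : v = 0 := hU i v fun j hj => by
      have := congrFun hv j
      rw [LinearMap.single_apply, Pi.single_eq_of_ne hj] at this
      exact (Submodule.Quotient.mk_eq_zero _).1 this
    subst this
    have := congrFun hv i
    rw [LinearMap.single_apply, Pi.single_eq_same, map_zero] at this
    exact this.symm
  have hπσ : ∀ x, π x = ∑ i, σ i (x i) := by
    intro x
    conv_lhs => rw [← LinearMap.sum_single_apply (fun i => V ⧸ U i) x]
    rw [map_sum]
    rfl
  have hE : finrank K (((i : ι) → V ⧸ U i) ⧸ LinearMap.range δ) = m := by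
    have h1 := (LinearMap.range δ).finrank_quotient_add_finrank
    rw [finrank_pi_fintype, LinearMap.finrank_range_of_inj hδinj] at h1
    omega
  have hr : ∀ i, finrank K (LinearMap.range (σ i)) = finrank K (V ⧸ U i) := fun i =>
    LinearMap.finrank_range_of_inj (hσinj i)
  have hstab : finrank K (stab fun i => LinearMap.range (σ i)) ≤ finrank K (stab U) := by
    let R : Submodule K
        (((((i : ι) → V ⧸ U i) ⧸ LinearMap.range δ) →ₗ[K] _ ⧸ LinearMap.range δ) ×
          (V →ₗ[K] V)) :=
      { carrier := {x | ∀ i v, x.1 (σ i ((U i).mkQ v)) = σ i ((U i).mkQ (x.2 v))}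
        add_mem' := fun {x y} hx hy i v => by simp [hx i v, hy i v, -Submodule.mkQ_apply]
        zero_mem' := fun i v => by simp
        smul_mem' := fun c x hx i v => by simp [hx i v, -Submodule.mkQ_apply] }
    refine finrank_le_of_relation R ?_ ?_
    · intro X hX
      rw [mem_stab] at hX
      choose Y hY using fun i => exists_comp_eq_of_injective (hσinj i) (X ∘ₗ σ i)
        fun q => hX i _ ⟨q, rfl⟩
      let Z : ((i : ι) → V ⧸ U i) →ₗ[K] ((i : ι) → V ⧸ U i) :=
        LinearMap.pi fun i => Y i ∘ₗ LinearMap.proj i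
      have hZ : ∀ x, π (Z x) = X (π x) := by
        intro x
        rw [hπσ, hπσ, map_sum]
        exact Finset.sum_congr rfl fun i _ => hY i (x i)
      obtain ⟨X', hX'⟩ := exists_comp_eq_of_injective hδinj (Z ∘ₗ δ) fun v =>
        (hπ _).1 (by rw [LinearMap.comp_apply, hZ, (hπ _).2 ⟨v, rfl⟩, map_zero])
      have hq : ∀ i v, (U i).mkQ (X' v) = Y i ((U i).mkQ v) := fun i v => congrFun (hX' v) i
      refine ⟨X', mem_stab.2 fun i u hu => ?_, fun i v => ?_⟩
      · have := hq i u
        rwa [(Submodule.Quotient.mk_eq_zero (U i)).2 hu |> fun e => (e : (U i).mkQ u = 0),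
          map_zero, Submodule.mkQ_apply, Submodule.Quotient.mk_eq_zero] at this
      · change X _ = σ i ((U i).mkQ (X' v))
        rw [hq, hY]
        rfl
    · intro X hX
      refine LinearMap.ext fun y => ?_
      obtain ⟨x, rfl⟩ := (LinearMap.range δ).mkQ_surjective y
      change X (π x) = 0
      rw [hπσ, map_sum]
      refine Finset.sum_eq_zero fun i _ => ?_
      obtain ⟨v, hv⟩ := (U i).mkQ_surjective (x i)
      rw [← hv]
      exact (hX i v).trans (by simp)
  have hrigid : Rigid fun i => LinearMap.range (σ i) := by
    rw [rigid_iff_finrank_stab] at h ⊢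
    simp only [hr]
    rw [hE]
    have e1 : ∀ i, (finrank K (U i) : ℤ) = finrank K V - finrank K (V ⧸ U i) := fun i => by
      have := (U i).finrank_quotient_add_finrank
      omega
    have e2 : ∀ i, (finrank K (_ ⧸ LinearMap.range (σ i)) : ℤ) = m - finrank K (V ⧸ U i) :=
      fun i => by
        have := (LinearMap.range (σ i)).finrank_quotient_add_finrank
        rw [hr, hE] at this
        omega
    -- With q i = dim V/U i, n = dim V and ∑ q i = m + n, the quantity n² - ∑ q i (n - q i) equals ∑
    -- (q i)² - mn, which is symmetric in m and n.
    zify at h hm hstab ⊢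
    simp only [e1, e2, sub_mul, mul_sub, Finset.sum_sub_distrib, ← Finset.mul_sum,
      ← Finset.sum_mul, ← hm] at h ⊢
    nlinarith
  obtain ⟨e⟩ : Nonempty (_ ≃ₗ[K] (Fin m → K)) :=
    FiniteDimensional.nonempty_linearEquiv_of_finrank_eq (hE.trans (by simp))
  exact ⟨_, fun i => (e.finrank_map_eq _).trans (hr i), hrigid.map e⟩

end

/-! ### Duality -/

section

variable {K V D ι : Type*} [Field K] [AddCommGroup V] [Module K V] [AddCommGroup D] [Module K D]

/-- Transposition carries the stabilizer of the annihilators into that of the subspaces. The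
equivalence `e` allows the dual to be realized on K^n itself. -/
theorem finrank_stab_le_of_dual [FiniteDimensional K V] [FiniteDimensional K D]
    {U : ι → Submodule K V} {W : ι → Submodule K D} (e : D ≃ₗ[K] Dual K V)
    (hW : ∀ i, ∀ f ∈ W i, ∀ u ∈ U i, e f u = 0) (hU : ∀ i v, (∀ f ∈ W i, e f v = 0) → v ∈ U i) :
    finrank K (stab W) ≤ finrank K (stab U) := by
  let R : Submodule K ((D →ₗ[K] D) × (V →ₗ[K] V)) :=
    { carrier := {x | ∀ f v, e (x.1 f) v = e f (x.2 v)}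
      add_mem' := fun {x y} hx hy f v => by
        change e (x.1 f + y.1 f) v = e f (x.2 v + y.2 v)
        rw [map_add, map_add, LinearMap.add_apply, hx f v, hy f v]
      zero_mem' := fun f v => by
        change e 0 v = e f 0
        rw [map_zero, map_zero, LinearMap.zero_apply]
      smul_mem' := fun c x hx f v => by
        change e (c • x.1 f) v = e f (c • x.2 v)
        rw [map_smul, map_smul, LinearMap.smul_apply, hx f v] }
  refine finrank_le_of_relation R ?_ ?_
  · intro Y hY
    rw [mem_stab] at hY
    let X : V →ₗ[K] V := (evalEquiv K V).symm.toLinearMap ∘ₗ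
      ((e : D →ₗ[K] Dual K V) ∘ₗ Y ∘ₗ (e.symm : Dual K V →ₗ[K] D)).dualMap ∘ₗ
        (evalEquiv K V).toLinearMap
    have hX : ∀ (f : Dual K V) (v : V), e (Y (e.symm f)) v = f (X v) := fun f v => by
      simp [X]
    refine ⟨X, mem_stab.2 fun i u hu => hU i _ fun f hf => ?_, fun f v => ?_⟩
    · rw [← hX, e.symm_apply_apply]
      exact hW i _ (hY i f hf) u hu
    · rw [← hX, e.symm_apply_apply]
  · intro Y hY
    refine LinearMap.ext fun f => e.injective (LinearMap.ext fun v => ?_)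
    exact (hY f v).trans (by simp)

theorem Rigid.dual [FiniteDimensional K V] [FiniteDimensional K D] [Fintype ι]
    {U : ι → Submodule K V} (h : Rigid U) (e : D ≃ₗ[K] Dual K V) :
    ∃ W : ι → Submodule K D, (∀ i, finrank K (W i) = finrank K (V ⧸ U i)) ∧ Rigid W := by
  have hr : ∀ i, finrank K ((U i).dualAnnihilator.map (e.symm : Dual K V →ₗ[K] D)) =
      finrank K (V ⧸ U i) := fun i => by
    have h1 := (U i).finrank_quotient_add_finrank
    have h2 := Subspace.finrank_add_finrank_dualAnnihilator_eq (U i)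
    have h3 := e.symm.finrank_map_eq (U i).dualAnnihilator
    omega
  have hD : finrank K D = finrank K V := e.finrank_eq.trans Subspace.dual_finrank_eq
  have hstab : finrank K (stab fun i =>
      (U i).dualAnnihilator.map (e.symm : Dual K V →ₗ[K] D)) ≤ finrank K (stab U) := by
    refine finrank_stab_le_of_dual e ?_ ?_
    · rintro i _ ⟨f, hf, rfl⟩ u hu
      simpa using (Submodule.mem_dualAnnihilator f).1 hf u hu
    · intro i v hv
      refine (Subspace.forall_mem_dualAnnihilator_apply_eq_zero_iff (U i) v).1 fun f hf => ?_
      simpa using hv _ ⟨f, hf, rfl⟩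
  refine ⟨_, hr, ?_⟩
  rw [rigid_iff_finrank_stab] at h ⊢
  have e2 : ∀ i, finrank K (D ⧸ (U i).dualAnnihilator.map (e.symm : Dual K V →ₗ[K] D)) =
      finrank K (U i) := fun i => by
    have h1 := ((U i).dualAnnihilator.map (e.symm : Dual K V →ₗ[K] D)).finrank_quotient_add_finrank
    have h2 := (U i).finrank_quotient_add_finrank
    rw [hr, hD] at h1
    omega
  have e3 : ∑ i, finrank K ((U i).dualAnnihilator.map (e.symm : Dual K V →ₗ[K] D)) *
      finrank K (D ⧸ (U i).dualAnnihilator.map (e.symm : Dual K V →ₗ[K] D)) =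
      ∑ i, finrank K (U i) * finrank K (V ⧸ U i) :=
    Finset.sum_congr rfl fun i _ => by rw [hr, e2, mul_comm]
  rw [e3, hD]
  omega

end

/-! ### Existence of rigid configurations -/

/-- There is a rigid family of subspaces of `K ^ n` with the given dimensions. -/
def HasRigid (K : Type*) [Field K] {ι : Type*} (n : ℕ) (d : ι → ℕ) : Prop :=
  ∃ U : ι → Submodule K (Fin n → K), (∀ i, finrank K (U i) = d i) ∧ Rigid U

section

variable {K V : Type*} [Field K] [AddCommGroup V] [Module K V] {ι : Type*}

theorem Rigid.hasRigid [FiniteDimensional K V] {U : ι → Submodule K V} (h : Rigid U) {n : ℕ}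
    {d : ι → ℕ} (hn : finrank K V = n) (hd : ∀ i, finrank K (U i) = d i) : HasRigid K n d := by
  obtain ⟨e⟩ : Nonempty (V ≃ₗ[K] (Fin n → K)) :=
    FiniteDimensional.nonempty_linearEquiv_of_finrank_eq (hn.trans (by simp))
  exact ⟨_, fun i => (e.finrank_map_eq _).trans (hd i), h.map e⟩

theorem finrank_submodule_prod {W : Type*} [AddCommGroup W] [Module K W] [FiniteDimensional K V]
    [FiniteDimensional K W] (p : Submodule K V) (q : Submodule K W) :
    finrank K (p.prod q) = finrank K p + finrank K q := by
  have h : p.prod q = LinearMap.range (p.subtype.prodMap q.subtype) := by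
    rw [LinearMap.range_prodMap, Submodule.range_subtype, Submodule.range_subtype]
  rw [h, LinearMap.finrank_range_of_inj, finrank_prod]
  exact p.injective_subtype.prodMap q.injective_subtype

theorem hasRigid_of_sum_le [Fintype ι] {n : ℕ} {d : ι → ℕ} (h : ∑ i, d i ≤ n) :
    HasRigid K n d := by
  classical
  refine (rigid_coordinate (K := K) d (n - ∑ i, d i)).hasRigid ?_ fun i => ?_
  · rw [finrank_prod, finrank_pi_fintype]
    simp [h]
  · rw [LinearMap.finrank_range_of_inj]
    · simp
    · exact LinearMap.inl_injective.comp (LinearMap.ker_eq_bot.1 (LinearMap.ker_single K _ i))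

theorem HasRigid.of_update_zero [DecidableEq ι] {n : ℕ} {d : ι → ℕ} {i : ι} (hi : d i = n)
    (h : HasRigid K n (Function.update d i 0)) : HasRigid K n d := by
  obtain ⟨U, hU, hr⟩ := h
  refine ⟨_, fun j => ?_, hr.update_top i⟩
  by_cases hj : j = i
  · subst hj
    rw [Function.update_self, finrank_top, finrank_fin_fun, hi]
  · rw [Function.update_of_ne hj, hU, Function.update_of_ne hj]

/-- The dimensions other than d i add up to n, which is exactly what `Rigid.exists_functional` needs
to provide the gluing condition of `Rigid.prod_update`. -/
theorem HasRigid.split_off [Fintype ι] [DecidableEq ι] {n r : ℕ} {d : ι → ℕ} {i : ι}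
    (hd : ∑ j ∈ Finset.univ.erase i, d j = n) (hi : r ≤ d i)
    (h : HasRigid K n (Function.update d i (d i - r))) : HasRigid K (n + r) d := by
  obtain ⟨U, hU, hr⟩ := h
  refine (hr.prod_update i (fun β => ?_) r).hasRigid (by simp) fun j => ?_
  · have hs : ∑ j ∈ Finset.univ.erase i, finrank K (U j) = finrank K (Fin n → K) := by
      refine (Finset.sum_congr rfl fun j hj => ?_).trans (hd.trans (finrank_fin_fun K).symm)
      rw [hU, Function.update_of_ne (Finset.ne_of_mem_erase hj)]
    obtain ⟨ξ, hξ⟩ := hr.exists_functional (Finset.univ.erase i) hs β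
    exact ⟨ξ, fun j hj => hξ j (by simp [hj])⟩
  · rw [finrank_submodule_prod, hU]
    by_cases hj : j = i
    · subst hj
      rw [Function.update_self, if_pos rfl, finrank_top, finrank_fin_fun]
      omega
    · rw [Function.update_of_ne hj, if_neg hj, finrank_bot, add_zero]

theorem HasRigid.reflect [Fintype ι] [DecidableEq ι] [Nonempty ι] {m n : ℕ} {d : ι → ℕ}
    (hmn : m + n = ∑ i, d i) (hd : ∀ i, d i ≤ m) (hn : ∀ i, d i ≤ n)
    (h : HasRigid K m fun i => m - d i) : HasRigid K n d := by
  obtain ⟨U, hU, hr⟩ := h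
  have hq : ∀ i, finrank K ((Fin m → K) ⧸ U i) = d i := fun i => by
    have h1 := (U i).finrank_quotient_add_finrank
    have h2 := hU i
    have := hd i
    rw [finrank_fin_fun] at h1
    simp only at h2
    omega
  have hU0 : ∀ i v, (∀ j, j ≠ i → v ∈ U j) → v = 0 := by
    intro i v hv
    refine hr.eq_zero_of_mem (Finset.univ.erase i) ?_ fun j hj => hv j (Finset.ne_of_mem_erase hj)
    simp only [hq, finrank_fin_fun]
    have := Finset.add_sum_erase Finset.univ d (Finset.mem_univ i)
    have := hn i
    omega
  obtain ⟨U', h1, h2⟩ := hr.exists_reflection hU0 (m := n)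
    (by simp only [hq, finrank_fin_fun]; omega)
  exact ⟨U', fun i => (h1 i).trans (hq i), h2⟩

theorem HasRigid.dual [Fintype ι] {n : ℕ} {d : ι → ℕ} (hd : ∀ i, d i ≤ n)
    (h : HasRigid K n fun i => n - d i) : HasRigid K n d := by
  obtain ⟨U, hU, hr⟩ := h
  obtain ⟨e⟩ : Nonempty ((Fin n → K) ≃ₗ[K] Dual K (Fin n → K)) :=
    FiniteDimensional.nonempty_linearEquiv_of_finrank_eq Subspace.dual_finrank_eq.symm
  obtain ⟨W, hW, hWr⟩ := hr.dual e
  refine ⟨W, fun i => ?_, hWr⟩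
  have h1 := (U i).finrank_quotient_add_finrank
  have h2 := hU i
  have := hd i
  rw [finrank_fin_fun] at h1
  simp only at h2
  rw [hW]
  omega

end

theorem hasRigid_of_sum_lt (K : Type*) [Field K] (n : ℕ) (d : Fin 4 → ℕ) (hd : ∀ i, d i ≤ n)
    (hsum : ∑ i, d i < 2 * n) : HasRigid K n d := by
  induction n using Nat.strong_induction_on generalizing d with
  | _ n ih =>
    by_cases h1 : ∑ i, d i ≤ n
    · exact hasRigid_of_sum_le h1
    push Not at h1
    have hsplit := fun i => Finset.add_sum_erase Finset.univ d (Finset.mem_univ i)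
    by_cases h2 : ∃ i, ∑ j ∈ Finset.univ.erase i, d j < n
    · obtain ⟨i, hi⟩ := h2
      have hi1 := hsplit i
      have hi2 := hd i
      have hu : ∀ c, ∑ j, Function.update d i c j = c + ∑ j ∈ Finset.univ.erase i, d j := by
        intro c
        rw [← Finset.add_sum_erase Finset.univ _ (Finset.mem_univ i), Function.update_self]
        congr 1
        exact Finset.sum_congr rfl fun j hj => Function.update_of_ne (Finset.ne_of_mem_erase hj) _ _
      -- After splitting off, the sum is below twice the new dimension only if d i < n. If d i = n,
      -- the subspace is the whole space, which has no deformations and can be traded for zero.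
      by_cases hin : d i = n
      · refine HasRigid.of_update_zero hin (hasRigid_of_sum_le ?_)
        rw [hu]
        omega
      · obtain ⟨r, hr⟩ := Nat.exists_eq_add_of_lt hi
        obtain rfl : n = ∑ j ∈ Finset.univ.erase i, d j + (r + 1) := by omega
        refine HasRigid.split_off rfl (by omega) (ih _ hi _ (fun j => ?_) ?_)
        · by_cases hj : j = i
          · subst hj
            rw [Function.update_self]
            omega
          · rw [Function.update_of_ne hj]
            exact Finset.single_le_sum (fun _ _ => Nat.zero_le _) (by simp [hj])
        · rw [hu]
          omega
    · push Not at h2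
      -- Put m = ∑ d i - n, so m < n. The reflected dimensions m - d i have sum 4m - (m + n) = 3m -
      -- n < 2m.
      have hm : (∑ i, d i - n) + n = ∑ i, d i := by omega
      have hdm : ∀ i, d i ≤ ∑ i, d i - n := fun i => by
        have := hsplit i
        have := h2 i
        omega
      refine HasRigid.reflect hm hdm hd (ih _ (by omega) _ (fun i => Nat.sub_le _ _) ?_)
      have h3 : ∑ i, (∑ i, d i - n - d i) + ∑ i, d i = 4 * (∑ i, d i - n) := by
        rw [← Finset.sum_add_distrib, Finset.sum_congr rfl fun i _ => Nat.sub_add_cancel (hdm i)]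
        simp
      omega

theorem hasRigid_of_sum_ne (K : Type*) [Field K] (n : ℕ) (d : Fin 4 → ℕ) (hd : ∀ i, d i ≤ n)
    (hsum : ∑ i, d i ≠ 2 * n) : HasRigid K n d := by
  rcases lt_or_gt_of_ne hsum with h | h
  · exact hasRigid_of_sum_lt K n d hd h
  · refine HasRigid.dual hd (hasRigid_of_sum_lt K n _ (fun i => Nat.sub_le _ _) ?_)
    have h3 : ∑ i, (n - d i) + ∑ i, d i = 4 * n := by
      rw [← Finset.sum_add_distrib, Finset.sum_congr rfl fun i _ => Nat.sub_add_cancel (hd i)]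
      simp
    omega

/-- A rigid configuration of at most four subspaces exists for all dimensions except those of four
subspaces of total dimension `2 * n`. -/
theorem hasRigid_of_le_four (K : Type*) [Field K] {k n : ℕ} (hk : k ≤ 4) (d : Fin k → ℕ)
    (hd : ∀ i, d i ≤ n) (h : ¬ (k = 4 ∧ ∑ i, d i = 2 * n)) : HasRigid K n d := by
  obtain rfl | hk' := hk.eq_or_lt
  · exact hasRigid_of_sum_ne K n d hd fun h' => h ⟨rfl, h'⟩
  obtain rfl | hn := n.eq_zero_or_pos
  · exact hasRigid_of_sum_le (by simp [fun i => Nat.le_zero.1 (hd i)])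
  suffices H : ∃ d' : Fin 4 → ℕ, (∀ i, d' i ≤ n) ∧ (∑ i, d' i ≠ 2 * n) ∧
      d' ∘ Fin.castLE hk = d by
    obtain ⟨d', h1, h2, rfl⟩ := H
    obtain ⟨U, hU, hr⟩ := hasRigid_of_sum_ne K n d' h1 h2
    exact ⟨_, fun i => hU _, hr.comp (Fin.castLE_injective hk)⟩
  -- Pad by zeros, with c in the last place, which is free because k < 4. If c = 0 gives the
  -- forbidden sum 2n, then c = n avoids it since n > 0.
  let e : ℕ → Fin 4 → ℕ := fun c i => if hi : i.1 < k then d ⟨i, hi⟩ else if i = 3 then c else 0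
  have he : ∀ c, ∑ i, e c i = e 0 0 + e 0 1 + e 0 2 + c := by
    intro c
    rw [Fin.sum_univ_four]
    have : e c 3 = c := by simp [e, show ¬ 3 < k by omega]
    rw [this]
    simp [e]
  have hle : ∀ c ≤ n, ∀ i, e c i ≤ n := by
    intro c hc i
    simp only [e]
    split_ifs
    exacts [hd _, hc, Nat.zero_le n]
  have hcomp : ∀ c, e c ∘ Fin.castLE hk = d := by
    intro c
    ext i
    simp [e]
  by_cases hs : ∑ i, e 0 i = 2 * n
  · refine ⟨e n, hle n le_rfl, ?_, hcomp n⟩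
    rw [he] at hs ⊢
    omega
  · exact ⟨e 0, hle 0 (Nat.zero_le n), hs, hcomp 0⟩

/-! ### Polynomials along curves -/

section

variable {K σ : Type*} [Field K]

theorem aeval_mul_of_isHomogeneous {S : Type*} [CommRing S] [Algebra K S]
    {φ : MvPolynomial σ K} {r : ℕ} (h : φ.IsHomogeneous r) (x : S) (y : σ → S) :
    MvPolynomial.aeval (fun s => x * y s) φ = x ^ r * MvPolynomial.aeval y φ := by
  simp only [MvPolynomial.aeval_def, MvPolynomial.eval₂_eq, Finset.mul_sum]
  refine Finset.sum_congr rfl fun m hm => ?_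
  have hr : ∑ i ∈ m.support, m i = r := by
    have := h.degree_eq_sum_deg_support hm
    exact this.symm
  simp only [mul_pow, Finset.prod_mul_distrib, Finset.prod_pow_eq_pow_sum, hr]
  ring

theorem aeval_aeval_X_add_C {S : Type*} [CommRing S] [Algebra K S] (p : MvPolynomial σ K)
    (a : σ → K) (y : σ → S) :
    MvPolynomial.aeval y (MvPolynomial.aeval
      (fun s => (MvPolynomial.X s + MvPolynomial.C (a s) : MvPolynomial σ K)) p) =
      MvPolynomial.aeval (fun s => y s + algebraMap K S (a s)) p := by
  rw [MvPolynomial.comp_aeval_apply]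
  simp

/-- A nonzero polynomial does not vanish identically along the curves `a + t b + t ^ 2 c`, if the
direction `b` is well chosen. -/
theorem exists_direction_aeval_ne_zero [Infinite K] {p : MvPolynomial σ K} (hp : p ≠ 0)
    (a : σ → K) : ∃ b : σ → K, ∀ c : σ → K, ∃ P : Polynomial K, P ≠ 0 ∧
      ∀ t, P.eval t = MvPolynomial.aeval (fun s => a s + t * b s + t ^ 2 * c s) p := by
  let q : MvPolynomial σ K :=
    MvPolynomial.aeval (fun s => MvPolynomial.X s + MvPolynomial.C (a s)) p
  have hq0 : q ≠ 0 := by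
    intro h0
    refine hp (MvPolynomial.funext fun x => ?_)
    have := aeval_aeval_X_add_C p a fun s => x s - a s
    change MvPolynomial.aeval _ q = _ at this
    rw [h0, map_zero] at this
    simpa [MvPolynomial.coe_aeval_eq_eval] using this.symm
  have hex : ∃ r, MvPolynomial.homogeneousComponent r q ≠ 0 := by
    by_contra! h
    refine hq0 ?_
    rw [← q.sum_homogeneousComponent]
    exact Finset.sum_eq_zero fun i _ => h i
  classical
  -- The lowest nonzero homogeneous component of p expanded at a, of degree r, is nonzero at some b.
  -- The t^r coefficient along the curve is its value at b, whatever c is.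
  let r := Nat.find hex
  have hr : MvPolynomial.homogeneousComponent r q ≠ 0 := Nat.find_spec hex
  have hlt : ∀ i < r, MvPolynomial.homogeneousComponent i q = 0 := fun i hi =>
    not_not.1 (Nat.find_min hex hi)
  have hrdeg : r ∈ Finset.range (q.totalDegree + 1) := by
    rw [Finset.mem_range]
    by_contra! h
    exact hr (MvPolynomial.homogeneousComponent_eq_zero _ _ (by omega))
  obtain ⟨b, hb⟩ : ∃ b : σ → K, MvPolynomial.aeval b (MvPolynomial.homogeneousComponent r q) ≠ 0 := by
    by_contra! h
    refine hr (MvPolynomial.funext fun x => ?_)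
    simpa [MvPolynomial.coe_aeval_eq_eval] using h x
  refine ⟨b, fun c => ?_⟩
  let y : σ → Polynomial K := fun s => Polynomial.C (b s) + Polynomial.X * Polynomial.C (c s)
  let P : Polynomial K := MvPolynomial.aeval (fun s => Polynomial.X * y s) q
  have heval : ∀ (t : K) (z : σ → Polynomial K) (f : MvPolynomial σ K),
      (MvPolynomial.aeval z f).eval t = MvPolynomial.aeval (fun s => (z s).eval t) f := by
    intro t z f
    rw [← Polynomial.coe_aeval_eq_eval, MvPolynomial.comp_aeval_apply]
  refine ⟨P, fun h0 => ?_, fun t => ?_⟩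
  · have hsum : P = ∑ i ∈ Finset.range (q.totalDegree + 1), Polynomial.X ^ i *
        MvPolynomial.aeval y (MvPolynomial.homogeneousComponent i q) := by
      simp only [P]
      conv_lhs => rw [← q.sum_homogeneousComponent]
      rw [map_sum]
      exact Finset.sum_congr rfl fun i _ =>
        aeval_mul_of_isHomogeneous (MvPolynomial.homogeneousComponent_isHomogeneous i q) _ _
    have hcoeff : P.coeff r =
        (MvPolynomial.aeval y (MvPolynomial.homogeneousComponent r q)).coeff 0 := by
      rw [hsum, Polynomial.finsetSum_coeff, Finset.sum_eq_single_of_mem r hrdeg]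
      · simp [Polynomial.coeff_X_pow_mul']
      · intro i _ hi
        rw [Polynomial.coeff_X_pow_mul']
        split_ifs with hir
        · rw [hlt i (by omega)]
          simp
        · rfl
    rw [h0, Polynomial.coeff_zero, Polynomial.coeff_zero_eq_eval_zero, heval] at hcoeff
    refine hb ?_
    simpa [y] using hcoeff.symm
  · rw [heval, aeval_aeval_X_add_C]
    congr 2
    ext s
    simp [y]
    ring

theorem exists_eval_eq_det_one_add {m : Type*} [Fintype m] [DecidableEq m] (M : Matrix m m K) :
    ∃ Q : Polynomial K, Q ≠ 0 ∧ ∀ t, Q.eval t = (1 + t • M).det := by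
  let Q : Polynomial K := (1 + (Polynomial.X : Polynomial K) • M.map Polynomial.C).det
  have hQ : ∀ t, Q.eval t = (1 + t • M).det := by
    intro t
    rw [← Polynomial.coe_evalRingHom, RingHom.map_det]
    congr 1
    ext i j
    simp [Matrix.one_apply, apply_ite (Polynomial.eval t)]
    ring
  refine ⟨Q, fun h => ?_, hQ⟩
  have := hQ 0
  simp [h] at this

end

/-! ### Tuples of frames -/

section

variable {K : Type*} [Field K] {k n : ℕ} {d : Fin k → ℕ}

/-- The coordinates of a tuple of frames. -/
def Frames.entries (A : Frames K d n) : (i : Fin k) × Fin n × Fin (d i) → K :=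
  fun e => A.1 e.1 e.2.1 e.2.2

theorem Frames.coe_toGr (A : Frames K d n) (i : Fin k) :
    (A.toGr i).1 = LinearMap.range (A.1 i).mulVecLin :=
  ((A.1 i).range_mulVecLin).symm

theorem Frames.mulVec_injective (A : Frames K d n) (i : Fin k) :
    Function.Injective (A.1 i).mulVec :=
  Matrix.mulVec_injective_iff.2 (A.2 i)

theorem Frames.toGr_surjective :
    Function.Surjective (Frames.toGr : Frames K d n → (i : Fin k) → Gr K (d i) n) := by
  intro U
  let b := fun i => finBasisOfFinrankEq K (U i).1 (U i).2
  have hcol : ∀ i, (Matrix.of fun r c => (b i c : Fin n → K) r).col =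
      (U i).1.subtype ∘ b i := fun i => rfl
  refine ⟨⟨fun i => Matrix.of fun r c => (b i c : Fin n → K) r, fun i => ?_⟩, funext fun i =>
    Subtype.ext ?_⟩
  · rw [hcol]
    exact (b i).linearIndependent.map' _ (U i).1.ker_subtype
  · change Submodule.span K (Set.range (Matrix.of fun r c => (b i c : Fin n → K) r).col) = _
    rw [hcol, Set.range_comp, Submodule.span_image, (b i).span_eq, Submodule.map_top,
      Submodule.range_subtype]

/-- With `Frames.exists_eq_mul`, this identifies the preimage of a PGL(n)-orbit with an orbit of
GL(n) × ∏ GL(d i) on frames. -/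
theorem Frames.exists_mul (A : Frames K d n) {g : Matrix (Fin n) (Fin n) K} (hg : g.det ≠ 0)
    {h : (i : Fin k) → Matrix (Fin (d i)) (Fin (d i)) K} (hh : ∀ i, (h i).det ≠ 0) :
    ∃ B : Frames K d n, (∀ i, B.1 i = g * A.1 i * h i) ∧
      B.toGr ∈ MulAction.orbit (PGL(n, K)) A.toGr := by
  have hgi : Function.Injective g.mulVec := Matrix.mulVec_injective_iff_isUnit.2
    ((Matrix.isUnit_iff_isUnit_det g).2 hg.isUnit)
  have hhu : ∀ i, IsUnit (h i) := fun i => (Matrix.isUnit_iff_isUnit_det _).2 (hh i).isUnit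
  let B : Frames K d n := ⟨fun i => g * A.1 i * h i, fun i => by
    rw [← Matrix.mulVec_injective_iff]
    have : (g * A.1 i * h i).mulVec = g.mulVec ∘ (A.1 i).mulVec ∘ (h i).mulVec := by
      ext v : 1
      simp [Matrix.mul_assoc]
    rw [this]
    exact hgi.comp ((A.mulVec_injective i).comp (Matrix.mulVec_injective_iff_isUnit.2 (hhu i)))⟩
  refine ⟨B, fun i => rfl,
    Matrix.ProjGenLinGroup.mk (Matrix.GeneralLinearGroup.mkOfDetNeZero g hg), funext fun i =>
      Subtype.ext ?_⟩
  change Submodule.map g.mulVecLin (A.toGr i).1 = _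
  rw [A.coe_toGr, B.coe_toGr, ← LinearMap.range_comp, ← Matrix.mulVecLin_mul]
  change _ = LinearMap.range (g * A.1 i * h i).mulVecLin
  have hsurj : LinearMap.range (h i).mulVecLin = ⊤ :=
    LinearMap.range_eq_top.2 (Matrix.mulVec_surjective_iff_isUnit.2 (hhu i))
  rw [Matrix.mulVecLin_mul _ (h i), LinearMap.range_comp, hsurj, Submodule.map_top]

theorem Frames.exists_eq_mul {A B : Frames K d n}
    (hB : B.toGr ∈ MulAction.orbit (PGL(n, K)) A.toGr) :
    ∃ g : Matrix (Fin n) (Fin n) K, g.det ≠ 0 ∧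
      ∃ h : (i : Fin k) → Matrix (Fin (d i)) (Fin (d i)) K, (∀ i, (h i).det ≠ 0) ∧
        ∀ i, B.1 i = g * A.1 i * h i := by
  obtain ⟨x, hx⟩ := hB
  obtain ⟨g, rfl⟩ := Matrix.ProjGenLinGroup.mk_surjective x
  have hg : IsUnit (g : Matrix (Fin n) (Fin n) K) := g.isUnit
  have hgi := Matrix.mulVec_injective_iff_isUnit.2 hg
  have hr : ∀ i, LinearMap.range ((g : Matrix (Fin n) (Fin n) K) * A.1 i).mulVecLin =
      LinearMap.range (B.1 i).mulVecLin := fun i => by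
    have : Submodule.map (Matrix.mulVecLin (g : Matrix (Fin n) (Fin n) K)) (A.toGr i).1 =
      (B.toGr i).1 := congrArg Subtype.val (congrFun hx i)
    rwa [A.coe_toGr, B.coe_toGr, ← LinearMap.range_comp, ← Matrix.mulVecLin_mul] at this
  have hinj : ∀ i, Function.Injective ((g : Matrix (Fin n) (Fin n) K) * A.1 i).mulVecLin := by
    intro i
    rw [Matrix.mulVecLin_mul]
    exact hgi.comp (A.mulVec_injective i)
  choose l hl using fun i => exists_comp_eq_of_injective (hinj i) (B.1 i).mulVecLin
    fun c => (hr i).symm ▸ ⟨c, rfl⟩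
  have hmul : ∀ i, B.1 i =
      (g : Matrix (Fin n) (Fin n) K) * A.1 i * LinearMap.toMatrix' (l i) := fun i => by
    refine Matrix.ext_of_mulVec_single fun c => ?_
    rw [← Matrix.mulVec_mulVec, LinearMap.toMatrix'_mulVec]
    exact (hl i _).symm
  refine ⟨g, ((Matrix.isUnit_iff_isUnit_det _).1 hg).ne_zero, _, fun i => ?_, hmul⟩
  refine ((Matrix.isUnit_iff_isUnit_det _).1 (Matrix.mulVec_injective_iff_isUnit.1 ?_)).ne_zero
  intro v w hvw
  refine B.mulVec_injective i ?_
  change (LinearMap.toMatrix' (l i)).mulVec v = (LinearMap.toMatrix' (l i)).mulVec w at hvw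
  rw [hmul i, ← Matrix.mulVec_mulVec, hvw, Matrix.mulVec_mulVec]

/-! ### Dense orbits and polynomials on frames -/

theorem dense_orbit_of_forall {U : (i : Fin k) → Gr K (d i) n}
    (H : ∀ p : MvPolynomial ((i : Fin k) × Fin n × Fin (d i)) K,
      (∀ A : Frames K d n, A.toGr ∈ MulAction.orbit (PGL(n, K)) U →
        MvPolynomial.aeval A.entries p = 0) → p = 0) :
    @Dense _ (grassmannZariski K d n) (MulAction.orbit (PGL(n, K)) U) := by
  let _ := grassmannZariski K d n
  let _ := framesZariski K d n
  let _ := affineZariski ((i : Fin k) × Fin n × Fin (d i)) K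
  rw [dense_iff_closure_eq, Set.eq_univ_iff_forall]
  intro W
  obtain ⟨A, rfl⟩ := Frames.toGr_surjective W
  have h1 : IsClosed (closure (MulAction.orbit (PGL(n, K)) U)) := isClosed_closure
  rw [isClosed_coinduced, isClosed_induced_iff] at h1
  obtain ⟨Z, hZ, hpre⟩ := h1
  obtain ⟨I, rfl⟩ := isClosed_affineZariski_iff.1 hZ
  have hI : ∀ p ∈ I, p = 0 := by
    intro p hp
    refine H p fun B hB => ?_
    have : B ∈ Frames.toGr ⁻¹' closure (MulAction.orbit (PGL(n, K)) U) := subset_closure hB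
    rw [← hpre] at this
    exact this p hp
  change A ∈ Frames.toGr ⁻¹' closure (MulAction.orbit (PGL(n, K)) U)
  rw [← hpre]
  intro p hp
  rw [hI p hp, map_zero]

/-- By `hp` the zero locus of p on frames is a union of fibres of `Frames.toGr`, so it descends to a
closed set of the quotient. -/
theorem aeval_entries_eq_zero_of_dense {U : (i : Fin k) → Gr K (d i) n}
    (hU : @Dense _ (grassmannZariski K d n) (MulAction.orbit (PGL(n, K)) U))
    (p : MvPolynomial ((i : Fin k) × Fin n × Fin (d i)) K)
    (hp : ∀ A B : Frames K d n, A.toGr = B.toGr → MvPolynomial.aeval A.entries p = 0 →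
      MvPolynomial.aeval B.entries p = 0)
    (hpU : ∀ A : Frames K d n, A.toGr ∈ MulAction.orbit (PGL(n, K)) U →
      MvPolynomial.aeval A.entries p = 0) (A : Frames K d n) :
    MvPolynomial.aeval A.entries p = 0 := by
  let _ := grassmannZariski K d n
  let _ := framesZariski K d n
  let _ := affineZariski ((i : Fin k) × Fin n × Fin (d i)) K
  let C : Set ((i : Fin k) → Gr K (d i) n) :=
    {W | ∀ B : Frames K d n, B.toGr = W → MvPolynomial.aeval B.entries p = 0}
  have hC : IsClosed C := by
    rw [isClosed_coinduced, isClosed_induced_iff]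
    refine ⟨_, isClosed_affineZariski_iff.2 ⟨Ideal.span {p}, rfl⟩, ?_⟩
    ext B
    rw [MvPolynomial.zeroLocus_span]
    simp only [Set.mem_preimage, Set.mem_singleton_iff, forall_eq]
    exact ⟨fun h B' hB' => hp B B' hB'.symm h, fun h => h B rfl⟩
  have hsub : MulAction.orbit (PGL(n, K)) U ⊆ C := fun W hW B hB => hpU B (hB ▸ hW)
  have := hC.closure_subset_iff.2 hsub
  rw [hU.closure_eq] at this
  exact this (Set.mem_univ A.toGr) A rfl

/-- Rigidity read on frames: X moves the subspaces, and Y absorbs the remaining change of basis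
within each. -/
theorem Rigid.exists_eq_add {A : Frames K d n} (h : Rigid fun i => (A.toGr i).1)
    (B : (i : Fin k) → Matrix (Fin n) (Fin (d i)) K) :
    ∃ (X : Matrix (Fin n) (Fin n) K) (Y : (i : Fin k) → Matrix (Fin (d i)) (Fin (d i)) K),
      ∀ i, B i = X * A.1 i + A.1 i * Y i := by
  choose L hL using fun i => (A.1 i).mulVecLin.exists_leftInverse_of_injective
    (LinearMap.ker_eq_bot.2 (A.mulVec_injective i))
  obtain ⟨X, hX⟩ := h fun i => (B i).mulVecLin ∘ₗ L i
  have hmem : ∀ i c, ((B i).mulVecLin - X ∘ₗ (A.1 i).mulVecLin) c ∈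
      LinearMap.range (A.1 i).mulVecLin := by
    intro i c
    have hX' : ∀ u ∈ (A.toGr i).1, X u - ((B i).mulVecLin ∘ₗ L i) u ∈ (A.toGr i).1 := hX i
    rw [A.coe_toGr] at hX'
    have := hX' _ ⟨c, rfl⟩
    rw [LinearMap.comp_apply, ← LinearMap.comp_apply (L i), hL, LinearMap.id_apply] at this
    simpa using Submodule.neg_mem _ this
  choose l hl using fun i => exists_comp_eq_of_injective (A.mulVec_injective i :
    Function.Injective (A.1 i).mulVecLin) _ (hmem i)
  refine ⟨LinearMap.toMatrix' X, fun i => LinearMap.toMatrix' (l i), fun i => ?_⟩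
  refine Matrix.ext_of_mulVec_single fun c => ?_
  rw [Matrix.add_mulVec, ← Matrix.mulVec_mulVec, ← Matrix.mulVec_mulVec,
    LinearMap.toMatrix'_mulVec, LinearMap.toMatrix'_mulVec]
  have := hl i (Pi.single c 1)
  simp only [Matrix.mulVecLin_apply, LinearMap.sub_apply, LinearMap.comp_apply] at this
  rw [this]
  abel

theorem Rigid.dense_orbit [Infinite K] {U : (i : Fin k) → Gr K (d i) n}
    (h : Rigid fun i => (U i).1) :
    @Dense _ (grassmannZariski K d n) (MulAction.orbit (PGL(n, K)) U) := by
  obtain ⟨A, rfl⟩ := Frames.toGr_surjective U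
  refine dense_orbit_of_forall fun p hp => ?_
  by_contra hp0
  obtain ⟨b, hb⟩ := exists_direction_aeval_ne_zero hp0 A.entries
  obtain ⟨X, Y, hXY⟩ := h.exists_eq_add fun i => Matrix.of fun r c => b ⟨i, r, c⟩
  -- The curve is (1 + tX) A (1 + tY) = A + t(XA + AY) + t² XAY. It stays in the orbit whenever the
  -- outer factors are invertible, which excludes finitely many t.
  obtain ⟨P, hP0, hP⟩ := hb fun e => (X * A.1 e.1 * Y e.1) e.2.1 e.2.2
  obtain ⟨Q, hQ0, hQ⟩ := exists_eval_eq_det_one_add X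
  choose R hR0 hR using fun i => exists_eval_eq_det_one_add (Y i)
  obtain ⟨t, ht⟩ : ∃ t, (P * Q * ∏ i, R i).eval t ≠ 0 := by
    by_contra! H
    have h0 : P * Q * ∏ i, R i = 0 :=
      Polynomial.funext fun t => by rw [H, Polynomial.eval_zero]
    exact mul_ne_zero (mul_ne_zero hP0 hQ0) (Finset.prod_ne_zero_iff.2 fun i _ => hR0 i) h0
  rw [Polynomial.eval_mul, Polynomial.eval_mul, Polynomial.eval_prod] at ht
  obtain ⟨hPQ, hRt⟩ := mul_ne_zero_iff.1 ht
  obtain ⟨hPt, hQt⟩ := mul_ne_zero_iff.1 hPQ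
  rw [hQ] at hQt
  obtain ⟨B, hB, hBorb⟩ := A.exists_mul hQt (h := fun i => 1 + t • Y i) fun i => by
    have := Finset.prod_ne_zero_iff.1 hRt i (Finset.mem_univ i)
    rwa [hR] at this
  refine hPt ?_
  rw [hP, ← hp B hBorb]
  congr 2
  ext ⟨i, r, c⟩
  have e1 : B.1 i = A.1 i + t • (X * A.1 i + A.1 i * Y i) + t ^ 2 • (X * A.1 i * Y i) := by
    rw [hB]
    simp only [Matrix.add_mul, Matrix.mul_add, Matrix.one_mul, Matrix.mul_one, Matrix.smul_mul,
      Matrix.mul_smul, smul_add, smul_smul, sq]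
    abel
  rw [← hXY] at e1
  simp [Frames.entries, e1]

theorem HasRigid.isDense [Infinite K] {δ : DimensionVector k} (h : HasRigid K δ.ambient δ.dim) :
    δ.IsDense K := by
  obtain ⟨U, hU, hr⟩ := h
  exact ⟨fun i => ⟨U i, hU i⟩, Rigid.dense_orbit (U := fun i => ⟨U i, hU i⟩) hr⟩

end

/-! ### Four subspaces and the cross-ratio -/

/-- Four lines in the plane with cross-ratio `c`. -/
def lineVec {K : Type*} [Field K] (c : K) : Fin 4 → Fin 2 → K :=
  ![![1, 0], ![0, 1], ![1, 1], ![1, c]]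

/-- The tensor products of four subspaces with the four lines of cross-ratio `c` in the plane are
linearly independent. -/
def PencilIndep {K V : Type*} [Field K] [AddCommGroup V] [Module K V] (c : K)
    (U : Fin 4 → Submodule K V) : Prop :=
  ∀ u : Fin 4 → V, (∀ i, u i ∈ U i) → (∀ a, ∑ i, lineVec c i a • u i = 0) → u = 0

section

variable {K V W : Type*} [Field K] [AddCommGroup V] [Module K V] [AddCommGroup W] [Module K W]

theorem sum_lineVec_smul_eq_zero_iff {c : K} {u : Fin 4 → V} :
    (∀ a, ∑ i, lineVec c i a • u i = 0) ↔ u 0 + u 2 + u 3 = 0 ∧ u 1 + u 2 + c • u 3 = 0 := by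
  simp [Fin.forall_fin_two, Fin.sum_univ_four, lineVec]

theorem PencilIndep.prod {c : K} {U : Fin 4 → Submodule K V} {T : Fin 4 → Submodule K W}
    (hU : PencilIndep c U) (hT : PencilIndep c T) : PencilIndep c fun i => (U i).prod (T i) := by
  intro u hu h
  have h1 := hU (fun i => (u i).1) (fun i => (hu i).1) fun a => by
    simpa [Prod.fst_sum] using congrArg Prod.fst (h a)
  have h2 := hT (fun i => (u i).2) (fun i => (hu i).2) fun a => by
    simpa [Prod.snd_sum] using congrArg Prod.snd (h a)
  exact funext fun i => Prod.ext (congrFun h1 i) (congrFun h2 i)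

theorem PencilIndep.of_prod {c : K} {U : Fin 4 → Submodule K V} {T : Fin 4 → Submodule K W}
    (h : PencilIndep c fun i => (U i).prod (T i)) : PencilIndep c U := by
  intro u hu h'
  have := h (fun i => (u i, 0)) (fun i => ⟨hu i, (T i).zero_mem⟩) fun a =>
    Prod.ext (by simpa [Prod.fst_sum] using h' a) (by simp [Prod.snd_sum])
  exact funext fun i => congrArg Prod.fst (congrFun this i)

theorem PencilIndep.map {c : K} {U : Fin 4 → Submodule K V} (h : PencilIndep c U)
    (e : V ≃ₗ[K] W) : PencilIndep c fun i => (U i).map (e : V →ₗ[K] W) := by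
  intro u hu h'
  have := h (fun i => e.symm (u i)) (fun i => by
    obtain ⟨v, hv, hvu⟩ := hu i
    rw [← hvu]
    simpa using hv) fun a => by
      have := congrArg e.symm (h' a)
      rw [map_sum, map_zero] at this
      simpa using this
  exact funext fun i => e.symm.map_eq_zero_iff.1 (congrFun this i)

/-- For c ≠ 0, 1 the four lines are pairwise distinct, so any two of the vectors are independent. -/
theorem pencilIndep_pair {c : K} (h0 : c ≠ 0) (h1 : c ≠ 1) {p q : Fin 4} (hpq : p ≠ q) :
    PencilIndep c fun i => if i = p ∨ i = q then (⊤ : Submodule K K) else ⊥ := by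
  intro u hu h
  obtain ⟨e1, e2⟩ := sum_lineVec_smul_eq_zero_iff.1 h
  have hu' : ∀ i, i ≠ p → i ≠ q → u i = 0 := fun i hip hiq => by
    simpa [hip, hiq] using hu i
  have h1' : c - 1 ≠ 0 := sub_ne_zero.2 h1
  rw [smul_eq_mul] at e2
  suffices H : u 0 = 0 ∧ u 1 = 0 ∧ u 2 = 0 ∧ u 3 = 0 by
    ext i
    fin_cases i
    exacts [H.1, H.2.1, H.2.2.1, H.2.2.2]
  have k0 := hu' 0
  have k1 := hu' 1
  have k2 := hu' 2
  have k3 := hu' 3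
  clear hu hu' h
  fin_cases p <;> fin_cases q <;> simp at hpq k0 k1 k2 k3 <;> simp_all
  all_goals
    have hu3 : u 3 = 0 :=
      (mul_eq_zero.1 (by linear_combination e2 - e1 : (c - 1) * u 3 = 0)).resolve_left h1'
    exact ⟨by simpa [hu3] using e1, hu3⟩

theorem pencilIndep_span_lineVec_iff {b c : K} :
    PencilIndep c (fun i => Submodule.span K {lineVec b i}) ↔ c ≠ b := by
  constructor
  · rintro h rfl
    -- For b = c the four tensors v i ⊗ v i are symmetric, hence dependent in a space of dimension
    -- 3. These coefficients give the relation.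
    have := h ![(c - 1) • lineVec c 0, (c - c ^ 2) • lineVec c 1, (-c) • lineVec c 2,
      (1 : K) • lineVec c 3] (fun i => by
        fin_cases i <;> exact Submodule.smul_mem _ _ (Submodule.mem_span_singleton_self _))
      (sum_lineVec_smul_eq_zero_iff.2 ⟨by
        ext j; fin_cases j <;> simp [lineVec]
        ring, by
        ext j; fin_cases j <;> simp [lineVec]
        ring⟩)
    have := congrFun (congrFun this 3) 0
    simp [lineVec] at this
  · intro hcb u hu h
    obtain ⟨e1, e2⟩ := sum_lineVec_smul_eq_zero_iff.1 h
    choose x hx using fun i => Submodule.mem_span_singleton.1 (hu i)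
    simp only [← hx] at e1 e2
    have a0 := congrFun e1 0
    have a1 := congrFun e1 1
    have b0 := congrFun e2 0
    have b1 := congrFun e2 1
    simp [lineVec] at a0 a1 b0 b1
    have x3 : x 3 = 0 := by
      have : (c - b) * x 3 = 0 := by linear_combination b0 - a1
      exact (mul_eq_zero.1 this).resolve_left (sub_ne_zero.2 hcb)
    have x2 : x 2 = 0 := by simpa [x3] using a1
    have x1 : x 1 = 0 := by simpa [x2, x3] using b1
    have x0 : x 0 = 0 := by simpa [x2, x3] using a0
    ext i : 1
    rw [← hx]
    fin_cases i <;> simp [x0, x1, x2, x3]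

/-- Subspaces of total dimension `2 * m` whose tensor products with the four lines of a nondegenerate
cross-ratio are independent. -/
theorem exists_pencilIndep (K : Type*) [Field K] (m : ℕ) (d : Fin 4 → ℕ) (hd : ∀ i, d i ≤ m)
    (hsum : ∑ i, d i = 2 * m) : ∃ U : Fin 4 → Submodule K (Fin m → K),
      (∀ i, finrank K (U i) = d i) ∧ ∀ c : K, c ≠ 0 → c ≠ 1 → PencilIndep c U := by
  induction m generalizing d with
  | zero =>
    refine ⟨fun _ => ⊥, fun i => ?_, fun c _ _ u hu _ => funext fun i => Subsingleton.elim _ _⟩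
    rw [finrank_bot]
    have := hd i
    omega
  | succ m ih =>
    -- A one-dimensional summand carried by the subspaces p and q is peeled off. The sum 2(m + 1)
    -- forces at least two positive entries and at most two equal to m + 1; p and q must include the
    -- latter.
    obtain ⟨p, q, hpq, hp, hq, hlt⟩ : ∃ p q : Fin 4, p ≠ q ∧ 0 < d p ∧ 0 < d q ∧
        ∀ i, i ≠ p → i ≠ q → d i ≤ m := by
      rw [Fin.sum_univ_four] at hsum
      by_contra! H
      have h01 := H 0 1 (by decide)
      have h02 := H 0 2 (by decide)
      have h03 := H 0 3 (by decide)
      have h12 := H 1 2 (by decide)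
      have h13 := H 1 3 (by decide)
      have h23 := H 2 3 (by decide)
      simp [Fin.exists_fin_succ, Fin.forall_fin_succ] at h01 h02 h03 h12 h13 h23 hd
      omega
    let f : Fin 4 → ℕ := fun i => if i = p ∨ i = q then 1 else 0
    have hf : ∀ i, f i ≤ d i := fun i => by
      by_cases h1 : i = p
      · subst h1; simpa [f] using Nat.succ_le_of_lt hp
      by_cases h2 : i = q
      · subst h2; simpa [f] using Nat.succ_le_of_lt hq
      simp [f, h1, h2]
    have hfs : ∑ i, f i = 2 := by
      rw [Finset.sum_boole, Finset.filter_or, Finset.filter_eq', Finset.filter_eq']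
      simp [Finset.card_pair hpq]
    have hsub : ∑ i, (d i - f i) + ∑ i, f i = ∑ i, d i := by
      rw [← Finset.sum_add_distrib]
      exact Finset.sum_congr rfl fun i _ => Nat.sub_add_cancel (hf i)
    obtain ⟨U, hU, hind⟩ := ih (fun i => d i - f i) (fun i => by
      by_cases h1 : i = p ∨ i = q
      · have := hd i
        simp only [f, if_pos h1]
        omega
      · push Not at h1
        exact (Nat.sub_le _ _).trans (hlt i h1.1 h1.2)) (by omega)
    obtain ⟨e⟩ : Nonempty (((Fin m → K) × K) ≃ₗ[K] (Fin (m + 1) → K)) :=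
      FiniteDimensional.nonempty_linearEquiv_of_finrank_eq (by simp)
    refine ⟨_, fun i => (e.finrank_map_eq _).trans ?_, fun c h0 h1 =>
      ((hind c h0 h1).prod (pencilIndep_pair h0 h1 hpq)).map e⟩
    rw [finrank_submodule_prod, hU]
    have := hf i
    simp only [f] at this ⊢
    by_cases hi : i = p ∨ i = q
    · rw [if_pos hi] at this
      rw [if_pos hi, if_pos hi, finrank_top, finrank_self]
      omega
    · rw [if_neg hi, if_neg hi, finrank_bot]
      omega

/-- Direct sum of four lines of cross-ratio b in the plane with a configuration of dimensions d i -
1 in K^(n-2) that is independent for every c ≠ 0, 1. The bounds 1 ≤ d i ≤ n - 1 leave room for it.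
-/
theorem exists_pencilIndep_iff_ne {n : ℕ} {d : Fin 4 → ℕ} (hpos : ∀ i, 0 < d i)
    (hlt : ∀ i, d i < n) (hsum : ∑ i, d i = 2 * n) {b : K} :
    ∃ U : Fin 4 → Submodule K (Fin n → K), (∀ i, finrank K (U i) = d i) ∧
      ∀ c : K, c ≠ 0 → c ≠ 1 → (PencilIndep c U ↔ c ≠ b) := by
  obtain ⟨m, rfl⟩ : ∃ m, n = m + 2 := ⟨n - 2, by have := hpos 0; have := hlt 0; omega⟩
  have hsub : ∑ i, (d i - 1) + ∑ _i : Fin 4, 1 = ∑ i, d i := by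
    rw [← Finset.sum_add_distrib]
    exact Finset.sum_congr rfl fun i _ => Nat.sub_add_cancel (hpos i)
  obtain ⟨T, hT, hind⟩ := exists_pencilIndep K m (fun i => d i - 1)
    (fun i => by have := hlt i; omega) (by rw [Finset.sum_const, Finset.card_univ, Fintype.card_fin, smul_eq_mul] at hsub; omega)
  obtain ⟨e⟩ : Nonempty (((Fin 2 → K) × (Fin m → K)) ≃ₗ[K] (Fin (m + 2) → K)) :=
    FiniteDimensional.nonempty_linearEquiv_of_finrank_eq (by simp [add_comm])
  refine ⟨_, fun i => (e.finrank_map_eq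
    ((Submodule.span K {lineVec b i}).prod (T i))).trans ?_, fun c h0 h1 => ⟨fun h => ?_, fun h =>
      ((pencilIndep_span_lineVec_iff.2 h).prod (hind c h0 h1)).map e⟩⟩
  · rw [finrank_submodule_prod, hT, finrank_span_singleton]
    · have := hpos i
      omega
    · intro h
      have h0 := congrFun h 0
      have h1 := congrFun h 1
      fin_cases i <;> simp [lineVec] at h0 h1
  · have h' := h.map e.symm
    simp only [← Submodule.map_comp, LinearEquiv.comp_coe, LinearEquiv.self_trans_symm,
      LinearEquiv.refl_toLinearMap, Submodule.map_id] at h'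
    exact pencilIndep_span_lineVec_iff.1 h'.of_prod

end

/-! ### The determinantal semi-invariants -/

section

variable {K : Type*} [Field K] {n : ℕ} {d : Fin 4 → ℕ}

/-- The block matrix whose columns are the tensor products of the columns of four matrices with the
four vectors of cross-ratio `c` in the plane. -/
def pencilMatrix (c : K) (A : (i : Fin 4) → Matrix (Fin n) (Fin (d i)) K) :
    Matrix (Fin 2 × Fin n) ((i : Fin 4) × Fin (d i)) K :=
  Matrix.of fun p q => lineVec c q.1 p.1 * A q.1 p.2 q.2

/-- The determinant of the pencil matrix, as a polynomial in the matrix entries. -/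
def pencilDet (e : (i : Fin 4) × Fin (d i) ≃ Fin 2 × Fin n) (c : K) :
    MvPolynomial ((i : Fin 4) × Fin n × Fin (d i)) K :=
  (Matrix.of fun (p : Fin 2 × Fin n) q =>
    MvPolynomial.C (lineVec c (e.symm q).1 p.1) *
      MvPolynomial.X ⟨(e.symm q).1, p.2, (e.symm q).2⟩).det

theorem aeval_pencilDet (e : (i : Fin 4) × Fin (d i) ≃ Fin 2 × Fin n) (c : K)
    (A : Frames K d n) : MvPolynomial.aeval A.entries (pencilDet e c) =
      ((pencilMatrix c A.1).submatrix id e.symm).det := by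
  rw [pencilDet, AlgHom.map_det]
  congr 1
  ext p q
  simp [pencilMatrix, Frames.entries]

/-- Neither outer factor involves c, which is why all the determinants share one weight. -/
theorem pencilMatrix_mul (c : K) {A B : (i : Fin 4) → Matrix (Fin n) (Fin (d i)) K}
    {g : Matrix (Fin n) (Fin n) K} {h : (i : Fin 4) → Matrix (Fin (d i)) (Fin (d i)) K}
    (hB : ∀ i, B i = g * A i * h i) : pencilMatrix c B =
      Matrix.kronecker (1 : Matrix (Fin 2) (Fin 2) K) g * pencilMatrix c A *
        Matrix.blockDiagonal' h := by
  ext ⟨a, r⟩ ⟨i, j⟩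
  simp only [pencilMatrix, Matrix.of_apply, hB, Matrix.mul_apply, Fintype.sum_prod_type,
    Fintype.sum_sigma]
  rw [Finset.sum_eq_single_of_mem i (Finset.mem_univ i)]
  · simp only [Matrix.blockDiagonal'_apply_eq, Finset.mul_sum]
    refine Finset.sum_congr rfl fun l _ => ?_
    rw [Finset.sum_eq_single_of_mem a (Finset.mem_univ a)]
    · simp only [Matrix.kronecker, Matrix.kroneckerMap_apply, Matrix.one_apply_eq, one_mul,
        Finset.sum_mul, Finset.mul_sum]
      exact Finset.sum_congr rfl fun s _ => by ring
    · intro b _ hb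
      simp [Matrix.one_apply_ne hb.symm]
  · intro i' _ hi'
    refine Finset.sum_eq_zero fun l _ => ?_
    rw [Matrix.blockDiagonal'_apply_ne _ _ _ hi', mul_zero]

/-- The pencil determinants for all cross-ratios scale by the same factor. -/
theorem exists_aeval_pencilDet_eq_mul (e : (i : Fin 4) × Fin (d i) ≃ Fin 2 × Fin n)
    {A B : Frames K d n} (hB : B.toGr ∈ MulAction.orbit (PGL(n, K)) A.toGr) :
    ∃ x : K, x ≠ 0 ∧ ∀ c : K, MvPolynomial.aeval B.entries (pencilDet e c) =
      x * MvPolynomial.aeval A.entries (pencilDet e c) := by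
  obtain ⟨g, hg, h, hh, hgh⟩ := Frames.exists_eq_mul hB
  refine ⟨(Matrix.kronecker (1 : Matrix (Fin 2) (Fin 2) K) g).det *
    (Matrix.blockDiagonal' h).det, ?_, fun c => ?_⟩
  · refine mul_ne_zero ?_
      (Matrix.det_ne_zero_of_right_inverse (B := Matrix.blockDiagonal' fun i => (h i)⁻¹) ?_)
    · rw [Matrix.kronecker, Matrix.det_kronecker, Matrix.det_one, one_pow, one_mul]
      exact pow_ne_zero _ hg
    · rw [← Matrix.blockDiagonal'_mul]
      simp only [Matrix.mul_nonsing_inv _ (hh _).isUnit]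
      exact Matrix.blockDiagonal'_one
  · rw [aeval_pencilDet, aeval_pencilDet, pencilMatrix_mul c hgh,
      ← Matrix.submatrix_mul_equiv _ _ id e.symm e.symm,
      ← Matrix.submatrix_mul_equiv _ _ id (Equiv.refl (Fin 2 × Fin n)) e.symm, Matrix.det_mul, Matrix.det_mul,
      Matrix.det_submatrix_equiv_self]
    simp
    ring

theorem aeval_pencilDet_ne_zero_iff (e : (i : Fin 4) × Fin (d i) ≃ Fin 2 × Fin n) (c : K)
    (A : Frames K d n) : MvPolynomial.aeval A.entries (pencilDet e c) ≠ 0 ↔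
      PencilIndep c fun i => (A.toGr i).1 := by
  have hmul : ∀ v : Fin 2 × Fin n → K, ((pencilMatrix c A.1).submatrix id e.symm).mulVec v =
      fun p => (∑ i, lineVec c i p.1 • (A.1 i).mulVec (fun j => v (e ⟨i, j⟩))) p.2 := by
    intro v
    ext p
    simp only [Matrix.mulVec, dotProduct, Matrix.submatrix_apply, id]
    rw [← e.sum_comp]
    simp only [Equiv.symm_apply_apply, Fintype.sum_sigma, pencilMatrix, Matrix.of_apply,
      Finset.sum_apply, Pi.smul_apply, smul_eq_mul, Finset.mul_sum, mul_assoc, Matrix.mulVec,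
      dotProduct]
  rw [aeval_pencilDet, ← not_iff_not, not_not, ← Matrix.exists_mulVec_eq_zero_iff]
  simp only [hmul, PencilIndep, A.coe_toGr]
  push Not
  constructor
  · rintro ⟨v, hv, h⟩
    refine ⟨fun i => (A.1 i).mulVec fun j => v (e ⟨i, j⟩), fun i => ⟨_, rfl⟩, fun a => ?_, ?_⟩
    · exact funext fun r => congrFun h (a, r)
    · intro h0
      refine hv (funext fun p => ?_)
      have h1 := A.mulVec_injective (e.symm p).1
        ((congrFun h0 (e.symm p).1).trans (Matrix.mulVec_zero _).symm)
      simpa using congrFun h1 (e.symm p).2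
  · rintro ⟨u, hu, h, h0⟩
    choose w hw using hu
    have hwe : ∀ i j, w (e.symm (e ⟨i, j⟩)).1 (e.symm (e ⟨i, j⟩)).2 = w i j := fun i j => by
      rw [Equiv.symm_apply_apply]
    obtain rfl : (fun i => (A.1 i).mulVec (w i)) = u := funext hw
    refine ⟨fun p => w (e.symm p).1 (e.symm p).2, fun hv => h0 (funext fun i => ?_), ?_⟩
    · have : w i = 0 := funext fun j => (hwe i j).symm.trans (congrFun hv (e ⟨i, j⟩))
      simp [this]
    · ext p
      simp only [hwe]
      exact congrFun (h p.1) p.2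

theorem not_dense_orbit [Infinite K] (hpos : ∀ i, 0 < d i) (hlt : ∀ i, d i < n)
    (hsum : ∑ i, d i = 2 * n) (U : (i : Fin 4) → Gr K (d i) n) :
    ¬ @Dense _ (grassmannZariski K d n) (MulAction.orbit (PGL(n, K)) U) := by
  intro hU
  obtain ⟨A, rfl⟩ := Frames.toGr_surjective U
  obtain ⟨e⟩ : Nonempty ((i : Fin 4) × Fin (d i) ≃ Fin 2 × Fin n) :=
    Fintype.card_eq.1 (by simp [hsum])
  have hframe : ∀ b : K, ∃ B : Frames K d n, ∀ c, c ≠ 0 → c ≠ 1 →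
      (MvPolynomial.aeval B.entries (pencilDet e c) ≠ 0 ↔ c ≠ b) := by
    intro b
    obtain ⟨T, hT, h⟩ := exists_pencilIndep_iff_ne (K := K) hpos hlt hsum (b := b)
    obtain ⟨B, hB⟩ := Frames.toGr_surjective (fun i => (⟨T i, hT i⟩ : Gr K (d i) n))
    refine ⟨B, fun c h0 h1 => ?_⟩
    rw [aeval_pencilDet_ne_zero_iff, hB]
    exact h c h0 h1
  have hself : ∀ {B B' : Frames K d n}, B.toGr = B'.toGr →
      B'.toGr ∈ MulAction.orbit (PGL(n, K)) B.toGr := fun h => h ▸ MulAction.mem_orbit_self _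
  have key : ∀ b c : K, b ≠ 0 → b ≠ 1 → c ≠ 0 → c ≠ 1 → b ≠ c →
      MvPolynomial.aeval A.entries (pencilDet e b) = 0 := by
    intro b c hb0 hb1 hc0 hc1 hbc
    -- The combination f_c(A) f_b - f_b(A) f_c vanishes at A and is a semi-invariant, hence vanishes
    -- on the dense orbit and everywhere. At the frame B below, f_b is zero and f_c is not, so
    -- f_b(A) = 0.
    have hvan := aeval_entries_eq_zero_of_dense hU
      (MvPolynomial.C (MvPolynomial.aeval A.entries (pencilDet e c)) * pencilDet e b -
        MvPolynomial.C (MvPolynomial.aeval A.entries (pencilDet e b)) * pencilDet e c)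
      (fun B B' hBB hB => by
        obtain ⟨x, _, hx⟩ := exists_aeval_pencilDet_eq_mul e (hself hBB)
        simp only [map_sub, map_mul, MvPolynomial.aeval_C, Algebra.algebraMap_self,
          RingHom.id_apply, hx] at hB ⊢
        linear_combination x * hB)
      (fun B hB => by
        obtain ⟨x, _, hx⟩ := exists_aeval_pencilDet_eq_mul e hB
        simp only [map_sub, map_mul, MvPolynomial.aeval_C, Algebra.algebraMap_self,
          RingHom.id_apply, hx]
        ring)
    obtain ⟨B, hB⟩ := hframe b
    have h1 := (hB c hc0 hc1).2 hbc.symm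
    have h2 := not_not.1 (mt (hB b hb0 hb1).1 (not_not.2 rfl))
    have h3 := hvan B
    simp only [map_sub, map_mul, MvPolynomial.aeval_C, Algebra.algebraMap_self,
      RingHom.id_apply, h2, mul_zero, zero_sub, neg_eq_zero] at h3
    exact (mul_eq_zero.1 h3).resolve_right h1
  classical
  obtain ⟨b, hb⟩ := Infinite.exists_notMem_finset ({0, 1} : Finset K)
  obtain ⟨c, hc⟩ := Infinite.exists_notMem_finset ({0, 1, b} : Finset K)
  simp only [Finset.mem_insert, Finset.mem_singleton, not_or] at hb hc
  -- Now f_b(A) = 0 makes f_b vanish on all frames, although it is nonzero on this one of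
  -- cross-ratio c ≠ b.
  obtain ⟨B, hB⟩ := hframe c
  refine (hB b hb.1 hb.2).2 (Ne.symm hc.2.2) ?_
  refine aeval_entries_eq_zero_of_dense hU _ (fun B B' hBB h => ?_) (fun B hB => ?_) B
  · obtain ⟨x, _, hx⟩ := exists_aeval_pencilDet_eq_mul e (hself hBB)
    rw [hx, h, mul_zero]
  · obtain ⟨x, _, hx⟩ := exists_aeval_pencilDet_eq_mul e hB
    rw [hx, key b c hb.1 hb.2 hc.1 hc.2.1 (Ne.symm hc.2.2), mul_zero]

end

end GrassmannDensity

end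

theorem theorem5p1 {K : Type*} [Field K] [IsAlgClosed K] {k : ℕ} (hk : k ≤ 4)
    (d : GrassmannDensity.DimensionVector k) :
    (d.IsSparse K ↔ k = 4 ∧ ∑ i, d.dim i = 2 * d.ambient) ∧
      (k = 2 ∨ k = 3 → d.IsDense K) := by
  have : Infinite K := IsAlgClosed.instInfinite
  have hdense : ¬ (k = 4 ∧ ∑ i, d.dim i = 2 * d.ambient) → d.IsDense K := fun h =>
    (GrassmannDensity.hasRigid_of_le_four K hk d.dim (fun i => (d.lt_ambient i).le) h).isDense
  refine ⟨⟨fun h => by_contra fun h' => h (hdense h'), ?_⟩, fun h => hdense (by omega)⟩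
  rintro ⟨rfl, hsum⟩ ⟨U, hU⟩
  exact GrassmannDensity.not_dense_orbit d.pos d.lt_ambient hsum U hU
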